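/- A 01-partition (jagged partition) of a non-negative integer $n$ is a finite sequence $(n_1,\dots,n_m)$ of non-negative integers with $n_1+\dots+n_m=n$, whose last entry satisfies $n_m\ge 1$ (if $m \geq 1$), and such that $n_i\ge n_{i+1}-1$ for $1\le i\le m-1$ and $n_i\ge n_{i+2}$ for $1\le i\le m-2$. Let $j(n)$ be the (finite) number of 01-partitions of $n$, and write $(a;q)_\infty=\prod_{i\ge 0}(1-aq^i)$. Then, as formal power series in $q$ with rational coefficients, $$\sum_{n\ge 0} j(8n+7)\,q^n = 64\,\frac{(q^2;q^2)_\infty^{22}}{(q;q)_\infty^{23}}.$$ -/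

import Mathlib

open scoped PowerSeries.WithPiTopology

/-- The list `l = (n₁, …, n_m)` of non-negative integers is a 01-partition (jagged partition)
of `n`.  The empty list is the 01-partition of `0`. -/
structure Is01Partition (n : ℕ) (l : List ℕ) : Prop where
  sum_eq : l.sum = n
  last_pos : ∀ h : l ≠ [], 1 ≤ l.getLast h
  /-- `n_i ≥ n_{i+1} - 1` -/
  step_one : ∀ (i : ℕ) (h : i + 1 < l.length), l[i + 1] ≤ l[i] + 1
  /-- `n_i ≥ n_{i+2}` -/
  step_two : ∀ (i : ℕ) (h : i + 2 < l.length), l[i + 2] ≤ l[i]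

/-- The number of 01-partitions of `n`. -/
noncomputable def num01Partitions (n : ℕ) : ℕ :=
  {l : List ℕ | Is01Partition n l}.ncard

/-- The `q`-Pochhammer symbol `(a; q)_∞ = ∏_{i ≥ 0} (1 - a q^i)` for formal power series `a`, `q`
over `ℚ`; the infinite product is taken in the topology of coefficientwise convergence. -/
noncomputable def qPochhammerInf (a q : PowerSeries ℚ) : PowerSeries ℚ :=
  ∏' i : ℕ, (1 - a * q ^ i)

theorem Is01Partition.tail {n a : ℕ} {l : List ℕ} (h : Is01Partition n (a :: l)) :
    Is01Partition l.sum l where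
  sum_eq := rfl
  last_pos := fun hl => by
    have := h.last_pos (by simp)
    rwa [List.getLast_cons hl] at this
  step_one := fun i hi => by
    exact h.step_one (i + 1) (Nat.succ_lt_succ hi)
  step_two := fun i hi => by
    have h' : i + 1 + 2 < (a :: l).length := by simp only [List.length_cons]; omega
    exact h.step_two (i + 1) h'

theorem Is01Partition.one_le_add {n a b : ℕ} {l : List ℕ} (h : Is01Partition n (a :: b :: l)) :
    1 ≤ a + b := by
  induction l using List.twoStepInduction generalizing n a b with
  | nil => have := h.last_pos (by simp); simp at this; omega
  | singleton c =>
    have h1 := h.last_pos (by simp)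
    have h2 := h.step_two 0 (by simp)
    simp at h1 h2; omega
  | cons_cons c d l ih _ =>
    have h1 := ih h.tail.tail
    have h2 := h.step_two 0 (by simp)
    have h3 := h.step_two 1 (by simp)
    simp at h2 h3; omega

theorem Is01Partition.length_le {n : ℕ} {l : List ℕ} (h : Is01Partition n l) :
    l.length ≤ 2 * n := by
  induction l using List.twoStepInduction generalizing n with
  | nil => simp
  | singleton c =>
    have h1 := h.last_pos (by simp)
    have h2 := h.sum_eq
    simp at h1 h2 ⊢; omega
  | cons_cons c d l ih _ =>
    have h1 := ih h.tail.tail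
    have h2 := h.one_le_add
    have h3 := h.sum_eq
    simp at h3 ⊢; omega

/-- Only finitely many lists are counted by `num01Partitions n`. -/
theorem finite_is01Partition (n : ℕ) : {l : List ℕ | Is01Partition n l}.Finite := by
  refine Set.Finite.subset (List.finite_length_le (Fin (n + 1)) (2 * n) |>.image
    (List.map Fin.val)) fun l hl => ?_
  have hle : ∀ x ∈ l, x < n + 1 := fun x hx => by
    have := List.single_le_sum (fun _ _ => Nat.zero_le _) x hx
    have := hl.sum_eq
    omega
  refine ⟨l.pmap Fin.mk hle, ?_, ?_⟩
  · simpa using hl.length_le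
  · simp [List.map_pmap]

/-- The infinite product defining `(a; q)_∞` converges when `q` has no constant term. -/
theorem multipliable_qPochhammerInf (a q : PowerSeries ℚ)
    (hq : PowerSeries.constantCoeff q = 0) : Multipliable fun i : ℕ => 1 - a * q ^ i := by
  simp_rw [sub_eq_add_neg]
  apply PowerSeries.WithPiTopology.multipliable_one_add_of_tendsto_order_atTop_nhds_top
  refine ENat.tendsto_nhds_top_iff_natCast_lt.mpr
    fun n => Filter.eventually_atTop.mpr ⟨n + 1, fun m hm => ?_⟩
  rw [PowerSeries.order_neg]
  have h1 : (m : ℕ∞) ≤ (q ^ m).order := PowerSeries.le_order_pow_of_constantCoeff_eq_zero m hq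
  have h2 : (q ^ m).order ≤ (a * q ^ m).order :=
    le_trans le_add_self (PowerSeries.le_order_mul _ _)
  exact lt_of_lt_of_le (by exact_mod_cast hm) (h1.trans h2)

/-! Write φ(q) for the sum of q^(n²) and Ψ(q) = 2ψ(q) for the sum of q^(n(n+1)/2), both over all
integers n. Building a 01-partition by its largest allowed leading entries gives the generating
function 1/((q;q)_∞ (q;q²)_∞), which Gauss's product formula identifies with 1/φ(-q)
(`genFun01_mul_thetaPhiNeg`). Iterating φ(q)φ(-q) = φ(-q²)² three times turns this into φ(q) φ(q²)²
φ(q⁴)⁴ / φ(-q⁸)⁸ (`genFun01_mul_expand_thetaPhiNeg`). The denominator is a series in q⁸, so only the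
numerator needs dissecting. Its part of exponents 7 mod 8 collapses, through Ψ(q)² = 2φ(q)Ψ(q²), to
Ψ⁷/2 (`sect_genFun01_mul`). The product formulas for φ(-q) and ψ then give the quotient, with 64 =
2⁷/2. The theta identities come from changes of variables in ℤ², and the two product formulas from a
finite telescoping identity and a functional equation, so the Jacobi triple product is not needed.
-/

namespace PowerSeries

/-! ### Sums of monomials in the coefficientwise topology -/

section Continuity

variable {R : Type*} [CommRing R] [TopologicalSpace R]

theorem continuous_of_continuous_coeff {Y : Type*} [TopologicalSpace Y] {f : Y → PowerSeries R}
    (h : ∀ d, Continuous fun y => coeff d (f y)) : Continuous f := by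
  rw [continuous_iff_continuousAt]
  intro y
  rw [ContinuousAt, WithPiTopology.tendsto_iff_coeff_tendsto]
  exact fun d => (h d).continuousAt

theorem continuous_expand (p : ℕ) (hp : p ≠ 0) :
    Continuous (expand p hp : PowerSeries R → PowerSeries R) := by
  refine continuous_of_continuous_coeff fun d => ?_
  by_cases h : p ∣ d
  · obtain ⟨m, rfl⟩ := h
    simp_rw [coeff_expand_mul]
    exact WithPiTopology.continuous_coeff R m
  · simp_rw [coeff_expand_of_not_dvd p hp _ h]
    exact continuous_const

theorem continuous_rescale [IsTopologicalRing R] (a : R) :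
    Continuous (rescale a : PowerSeries R → PowerSeries R) := by
  refine continuous_of_continuous_coeff fun d => ?_
  simp_rw [coeff_rescale]
  exact continuous_const.mul (WithPiTopology.continuous_coeff R d)

/-- Each coefficient receives only finitely many nonzero terms, so no growth condition on `c` is
needed. -/
theorem summable_monomial_of_finite_fibers {ι : Type*} {w : ι → ℕ} (c : ι → R)
    (h : ∀ n, {i | w i = n}.Finite) : Summable fun i => monomial (w i) (c i) := by
  rw [WithPiTopology.summable_iff_summable_coeff]
  intro d
  refine summable_of_hasFiniteSupport ((h d).subset fun i hi => ?_)
  by_contra hne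
  exact hi (by simp only [coeff_monomial]; exact if_neg fun h => hne h.symm)

end Continuity

theorem finite_fibers_add {ι κ : Type*} {w : ι → ℕ} {v : κ → ℕ} (hw : ∀ n, {i | w i = n}.Finite)
    (hv : ∀ n, {i | v i = n}.Finite) (n : ℕ) : {x : ι × κ | w x.1 + v x.2 = n}.Finite := by
  have h1 : (⋃ k ∈ Finset.range (n + 1), {i | w i = k}).Finite :=
    Set.Finite.biUnion (Finset.finite_toSet _) fun k _ => hw k
  have h2 : (⋃ k ∈ Finset.range (n + 1), {i | v i = k}).Finite :=
    Set.Finite.biUnion (Finset.finite_toSet _) fun k _ => hv k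
  refine (h1.prod h2).subset fun x hx => ?_
  simp only [Set.mem_ofPred_eq] at hx
  simp only [Set.mem_prod, Set.mem_iUnion, Finset.mem_range, Set.mem_ofPred_eq, exists_prop,
    exists_eq_right']
  omega

theorem hasSum_of_forall_eq {ι M : Type*} [AddCommMonoid M] [TopologicalSpace M] {f g : ι → M}
    {a : M} (h : HasSum g a) (hfg : ∀ i, f i = g i) : HasSum f a :=
  (funext hfg : f = g) ▸ h

theorem hasSum_of_injective_isCompl {α β γ M : Type*} [AddCommMonoid M] [TopologicalSpace M]
    [ContinuousAdd M] {f : γ → M} {i : α → γ} {j : β → γ} (hi : i.Injective) (hj : j.Injective)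
    (hij : IsCompl (Set.range i) (Set.range j)) {a b : M} (ha : HasSum (fun x => f (i x)) a)
    (hb : HasSum (fun x => f (j x)) b) : HasSum f (a + b) :=
  HasSum.add_isCompl hij (hi.hasSum_range_iff.2 ha) (hj.hasSum_range_iff.2 hb)

theorem hasSum_monomial_mul {ι κ : Type*} {w : ι → ℕ} {v : κ → ℕ} {c : ι → ℚ} {d : κ → ℚ}
    (hw : ∀ n, {i | w i = n}.Finite) (hv : ∀ n, {i | v i = n}.Finite) {f g : PowerSeries ℚ}
    (hf : HasSum (fun i => monomial (w i) (c i)) f)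
    (hg : HasSum (fun i => monomial (v i) (d i)) g) :
    HasSum (fun x : ι × κ => monomial (w x.1 + v x.2) (c x.1 * d x.2)) (f * g) := by
  have := hf.mul hg (by
    simp_rw [monomial_mul_monomial]
    exact summable_monomial_of_finite_fibers _ (finite_fibers_add hw hv))
  simpa only [monomial_mul_monomial] using this

/-! ### The theta series -/

/-- Triangular numbers `n (n + 1) / 2` for `n : ℤ`. -/
def triangular (n : ℤ) : ℕ := (n * (n + 1) / 2).toNat

theorem two_mul_triangular (n : ℤ) : 2 * (triangular n : ℤ) = n * (n + 1) := by
  have h : 0 ≤ n * (n + 1) := by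
    rcases le_or_gt 0 n with h | h <;> nlinarith
  rw [triangular, Int.toNat_of_nonneg (by omega)]
  exact Int.two_mul_ediv_two_of_even (Int.even_mul_succ_self n)

theorem finite_triangular_eq (m : ℕ) : {n : ℤ | triangular n = m}.Finite := by
  refine (Set.finite_Icc (-(2 * m + 1) : ℤ) (2 * m + 1)).subset fun n hn => ?_
  have := two_mul_triangular n
  rw [show triangular n = m from hn] at this
  constructor <;> nlinarith

theorem finite_natAbs_sq_eq (m : ℕ) : {n : ℤ | n.natAbs ^ 2 = m}.Finite := by
  refine (Set.finite_Icc (-m : ℤ) m).subset fun n hn => ?_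
  have h : n.natAbs ≤ m := by
    rw [← show n.natAbs ^ 2 = m from hn]
    exact Nat.le_self_pow two_ne_zero _
  constructor <;> omega

theorem natCast_natAbs_sq (n : ℤ) : ((n.natAbs ^ 2 : ℕ) : ℤ) = n ^ 2 := by
  push_cast
  exact sq_abs n

/-- Ramanujan's theta function `φ(q) = ∑ q ^ (n ^ 2)`, the sum over all integers. -/
noncomputable def thetaPhi : PowerSeries ℚ := ∑' n : ℤ, monomial (n.natAbs ^ 2) 1

/-- The series `φ(-q)`. -/
noncomputable def thetaPhiNeg : PowerSeries ℚ := rescale (-1) thetaPhi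

/-- The series `∑ q ^ (n (n + 1) / 2)`, the sum over all integers; it is twice Ramanujan's
theta function `ψ(q)`. -/
noncomputable def thetaPsi : PowerSeries ℚ := ∑' n : ℤ, monomial (triangular n) 1

theorem hasSum_thetaPhi : HasSum (fun n : ℤ => monomial (n.natAbs ^ 2) (1 : ℚ)) thetaPhi :=
  (summable_monomial_of_finite_fibers _ finite_natAbs_sq_eq).hasSum

theorem hasSum_thetaPsi : HasSum (fun n : ℤ => monomial (triangular n) (1 : ℚ)) thetaPsi :=
  (summable_monomial_of_finite_fibers _ finite_triangular_eq).hasSum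

theorem neg_one_pow_natAbs_sq (n : ℤ) : (-1 : ℚ) ^ (n.natAbs ^ 2) = (-1) ^ n.natAbs := by
  rcases Nat.even_or_odd n.natAbs with h | h
  · rw [h.neg_one_pow, (h.pow_of_ne_zero two_ne_zero).neg_one_pow]
  · rw [h.neg_one_pow, h.pow.neg_one_pow]

theorem hasSum_thetaPhiNeg :
    HasSum (fun n : ℤ => monomial (n.natAbs ^ 2) ((-1 : ℚ) ^ n.natAbs)) thetaPhiNeg := by
  refine hasSum_of_forall_eq
    (hasSum_thetaPhi.map (rescale (-1 : ℚ)) (continuous_rescale _)) fun n => ?_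
  ext d
  simp only [Function.comp_apply, coeff_rescale, coeff_monomial]
  split_ifs with h
  · rw [h, neg_one_pow_natAbs_sq, mul_one]
  · simp

theorem hasSum_expand {ι : Type*} {w : ι → ℕ} {c : ι → ℚ} {f : PowerSeries ℚ} (p : ℕ) (hp : p ≠ 0)
    (hf : HasSum (fun i => monomial (w i) (c i)) f) :
    HasSum (fun i => monomial (p * w i) (c i)) (expand p hp f) := by
  refine hasSum_of_forall_eq (hf.map (expand p hp) (continuous_expand p hp)) fun i => ?_
  simp [expand_monomial]

theorem hasSum_X_mul {ι : Type*} {w : ι → ℕ} {c : ι → ℚ} {f : PowerSeries ℚ}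
    (hf : HasSum (fun i => monomial (w i) (c i)) f) :
    HasSum (fun i => monomial (1 + w i) (c i)) (X * f) := by
  refine hasSum_of_forall_eq (hf.mul_left X) fun i => ?_
  rw [X_eq, monomial_mul_monomial, one_mul]

theorem finite_fibers_const_mul {ι : Type*} {w : ι → ℕ} {p : ℕ} (hp : p ≠ 0)
    (hw : ∀ n, {i | w i = n}.Finite) (n : ℕ) : {i | p * w i = n}.Finite :=
  (hw (n / p)).subset fun i hi => by
    rw [Set.mem_ofPred_eq, ← show p * w i = n from hi, Nat.mul_div_cancel_left _ (by omega)]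

theorem isCompl_range_of_forall {α β γ : Type*} {i : α → γ} {j : β → γ}
    (h : ∀ a b, i a ≠ j b) (h' : ∀ c, (∃ a, i a = c) ∨ ∃ b, j b = c) :
    IsCompl (Set.range i) (Set.range j) := by
  refine ⟨Set.disjoint_left.2 ?_, codisjoint_iff.2 (Set.eq_univ_of_forall h')⟩
  rintro _ ⟨a, rfl⟩ ⟨b, hb⟩
  exact h a b hb.symm

theorem hasSum_monomial_congr {ι : Type*} {w v : ι → ℕ} {c d : ι → ℚ} {f : PowerSeries ℚ}
    (h : HasSum (fun i => monomial (v i) (d i)) f) (hw : ∀ i, (w i : ℤ) = v i)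
    (hc : ∀ i, c i = d i) : HasSum (fun i => monomial (w i) (c i)) f := by
  obtain rfl : w = v := funext fun i => by exact_mod_cast hw i
  obtain rfl : c = d := funext hc
  exact h

/-- The two-dissection `φ(q) = φ(q⁴) + 2 q ψ(q⁸)`. -/
theorem thetaPhi_eq_expand_add :
    thetaPhi = expand 4 (by norm_num) thetaPhi + X * expand 8 (by norm_num) thetaPsi := by
  refine hasSum_thetaPhi.unique (hasSum_of_injective_isCompl (i := fun n : ℤ => 2 * n)
    (j := fun n : ℤ => 2 * n + 1) (fun a b h => by simpa using h) (fun a b h => by simpa using h)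
    (isCompl_range_of_forall (fun a b => by omega) fun c => ?_) ?_ ?_)
  · rcases Int.even_or_odd' c with ⟨k, hk | hk⟩
    · exact Or.inl ⟨k, hk.symm⟩
    · exact Or.inr ⟨k, hk.symm⟩
  · refine hasSum_monomial_congr (hasSum_expand 4 (by norm_num) hasSum_thetaPhi)
      (fun n => ?_) fun _ => rfl
    push_cast [natCast_natAbs_sq]; simp only [sq_abs]; ring
  · refine hasSum_monomial_congr (hasSum_X_mul (hasSum_expand 8 (by norm_num) hasSum_thetaPsi))
      (fun n => ?_) fun _ => rfl
    have := two_mul_triangular n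
    push_cast [natCast_natAbs_sq]; simp only [sq_abs]; linear_combination (-4) * this

/-- This splits ℤ² into pairs of equal and of opposite parity. In the new coordinates m² + n²
becomes 2a² + 2b² on the first class and 1 + 2a(a+1) + 2b(b+1) on the second. -/
theorem isCompl_range_parity : IsCompl (Set.range fun x : ℤ × ℤ => (x.1 + x.2, x.1 - x.2))
    (Set.range fun x : ℤ × ℤ => (x.1 + x.2 + 1, x.1 - x.2)) := by
  refine isCompl_range_of_forall ?_ ?_
  · rintro ⟨a, b⟩ ⟨c, d⟩ h
    simp only [Prod.mk.injEq] at h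
    omega
  · rintro ⟨m, n⟩
    rcases Int.even_or_odd' (m + n) with ⟨k, hk | hk⟩
    · exact Or.inl ⟨(k, m - k), by simp only [Prod.mk.injEq]; omega⟩
    · exact Or.inr ⟨(k, m - k - 1), by simp only [Prod.mk.injEq]; omega⟩

theorem injective_add_sub : (fun x : ℤ × ℤ => (x.1 + x.2, x.1 - x.2)).Injective := by
  rintro ⟨a, b⟩ ⟨c, d⟩ h
  simp only [Prod.mk.injEq] at h ⊢
  omega

theorem injective_add_sub_succ : (fun x : ℤ × ℤ => (x.1 + x.2 + 1, x.1 - x.2)).Injective := by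
  rintro ⟨a, b⟩ ⟨c, d⟩ h
  simp only [Prod.mk.injEq] at h ⊢
  omega

/-- The two-dissection `φ(q)² = φ(q²)² + 4 q ψ(q⁴)²`. -/
theorem thetaPhi_sq : thetaPhi ^ 2 = expand 2 two_ne_zero thetaPhi ^ 2 +
    X * expand 4 four_ne_zero thetaPsi ^ 2 := by
  simp only [pow_two]
  refine (hasSum_monomial_mul finite_natAbs_sq_eq finite_natAbs_sq_eq hasSum_thetaPhi
    hasSum_thetaPhi).unique (hasSum_of_injective_isCompl injective_add_sub injective_add_sub_succ
    isCompl_range_parity ?_ ?_)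
  · refine hasSum_monomial_congr (hasSum_monomial_mul
      (finite_fibers_const_mul two_ne_zero finite_natAbs_sq_eq)
      (finite_fibers_const_mul two_ne_zero finite_natAbs_sq_eq)
      (hasSum_expand 2 two_ne_zero hasSum_thetaPhi)
      (hasSum_expand 2 two_ne_zero hasSum_thetaPhi))
      (fun x => ?_) fun _ => rfl
    push_cast [natCast_natAbs_sq]; simp only [sq_abs]; ring
  · refine hasSum_monomial_congr (hasSum_X_mul (hasSum_monomial_mul
      (finite_fibers_const_mul four_ne_zero finite_triangular_eq)
      (finite_fibers_const_mul four_ne_zero finite_triangular_eq)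
      (hasSum_expand 4 four_ne_zero hasSum_thetaPsi)
      (hasSum_expand 4 four_ne_zero hasSum_thetaPsi)))
      (fun x => ?_) fun _ => rfl
    have h1 := two_mul_triangular x.1
    have h2 := two_mul_triangular x.2
    push_cast [natCast_natAbs_sq]; simp only [sq_abs]; linear_combination (-2) * h1 - 2 * h2

theorem eq_zero_of_eq_neg {f : PowerSeries ℚ} (h : f = -f) : f = 0 := by
  ext d
  have := congrArg (coeff d) h
  rw [map_neg] at this
  rw [map_zero]
  linarith

/-- `φ(q) φ(-q) = φ(-q²)²`. -/
theorem thetaPhi_mul_thetaPhiNeg :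
    thetaPhi * thetaPhiNeg = expand 2 two_ne_zero thetaPhiNeg ^ 2 := by
  have key := hasSum_monomial_mul finite_natAbs_sq_eq finite_natAbs_sq_eq hasSum_thetaPhi
    hasSum_thetaPhiNeg
  have hodd : Summable fun x : ℤ × ℤ => monomial
      ((x.1 + x.2 + 1).natAbs ^ 2 + (x.1 - x.2).natAbs ^ 2) ((1 : ℚ) * (-1) ^ (x.1 - x.2).natAbs) :=
    summable_monomial_of_finite_fibers _ fun n =>
      (finite_fibers_add finite_natAbs_sq_eq finite_natAbs_sq_eq n).preimage
        injective_add_sub_succ.injOn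
  have hodd0 : ∑' x : ℤ × ℤ, monomial
      ((x.1 + x.2 + 1).natAbs ^ 2 + (x.1 - x.2).natAbs ^ 2)
        ((1 : ℚ) * (-1) ^ (x.1 - x.2).natAbs) = 0 := by
    -- The reflection b ↦ -1 - b exchanges a+b+1 and a-b. The exponent is unchanged, but the two
    -- numbers have opposite parity, so the sign flips and the sum cancels.
    let σ : Equiv.Perm (ℤ × ℤ) := Function.Involutive.toPerm (fun x => (x.1, -1 - x.2))
      fun x => by simp
    refine eq_zero_of_eq_neg ((σ.tsum_eq _).symm.trans ?_)
    rw [← tsum_neg]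
    refine tsum_congr fun x => ?_
    have h1 : (x.1 + (-1 - x.2) + 1).natAbs ^ 2 + (x.1 - (-1 - x.2)).natAbs ^ 2 =
        (x.1 + x.2 + 1).natAbs ^ 2 + (x.1 - x.2).natAbs ^ 2 := by
      zify
      simp only [sq_abs]
      ring
    have h2 : (-1 : ℚ) ^ (x.1 - (-1 - x.2)).natAbs = -(-1) ^ (x.1 - x.2).natAbs := by
      rw [← neg_one_mul ((-1 : ℚ) ^ _), ← pow_succ', neg_one_pow_eq_pow_mod_two,
        neg_one_pow_eq_pow_mod_two (n := _ + 1)]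
      congr 1
      omega
    change monomial ((x.1 + (-1 - x.2) + 1).natAbs ^ 2 + (x.1 - (-1 - x.2)).natAbs ^ 2)
      ((1 : ℚ) * (-1) ^ (x.1 - (-1 - x.2)).natAbs) = _
    rw [h1, h2, mul_neg, map_neg]
  have := key.unique (hasSum_of_injective_isCompl injective_add_sub injective_add_sub_succ
    isCompl_range_parity (b := 0) (a := expand 2 two_ne_zero thetaPhiNeg ^ 2) ?_
    (hodd0 ▸ hodd.hasSum))
  · simpa using this
  · rw [pow_two]
    refine hasSum_monomial_congr (hasSum_monomial_mul
      (finite_fibers_const_mul two_ne_zero finite_natAbs_sq_eq)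
      (finite_fibers_const_mul two_ne_zero finite_natAbs_sq_eq)
      (hasSum_expand 2 two_ne_zero hasSum_thetaPhiNeg)
      (hasSum_expand 2 two_ne_zero hasSum_thetaPhiNeg)) (fun x => ?_) fun x => ?_
    · push_cast [natCast_natAbs_sq]; simp only [sq_abs]; ring
    · rw [one_mul, ← pow_add, neg_one_pow_eq_pow_mod_two,
        neg_one_pow_eq_pow_mod_two (n := x.1.natAbs + _)]
      congr 1
      omega

/-- `ψ(q)² = φ(q) ψ(q²)`. -/
theorem thetaPsi_sq : thetaPsi ^ 2 = 2 * (thetaPhi * expand 2 two_ne_zero thetaPsi) := by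
  have hm := hasSum_monomial_mul (finite_fibers_const_mul two_ne_zero finite_triangular_eq)
    finite_natAbs_sq_eq (hasSum_expand 2 two_ne_zero hasSum_thetaPsi) hasSum_thetaPhi
  rw [pow_two, two_mul, mul_comm thetaPhi]
  -- The map n ↦ -1 - n preserves triangular numbers and flips the parity of m + n. Both parity
  -- classes therefore give the same sum, of exponents 2T(a) + b², which accounts for the factor 2.
  refine (hasSum_monomial_mul finite_triangular_eq finite_triangular_eq hasSum_thetaPsi
    hasSum_thetaPsi).unique (hasSum_of_injective_isCompl
    (i := fun x : ℤ × ℤ => (x.1 + x.2, x.1 - x.2))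
    (j := fun x : ℤ × ℤ => (x.1 + x.2, -1 - (x.1 - x.2))) injective_add_sub ?_
    (isCompl_range_of_forall ?_ ?_) ?_ ?_)
  · rintro ⟨a, b⟩ ⟨c, d⟩ h
    simp only [Prod.mk.injEq] at h ⊢
    omega
  · rintro ⟨a, b⟩ ⟨c, d⟩ h
    simp only [Prod.mk.injEq] at h
    omega
  · rintro ⟨m, n⟩
    rcases Int.even_or_odd' (m + n) with ⟨k, hk | hk⟩
    · exact Or.inl ⟨(k, m - k), by simp only [Prod.mk.injEq]; omega⟩
    · exact Or.inr ⟨(m - k - 1, k + 1), by simp only [Prod.mk.injEq]; omega⟩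
  · refine hasSum_monomial_congr hm (fun x => ?_) fun _ => rfl
    have h1 := two_mul_triangular x.1
    have h3 := two_mul_triangular (x.1 + x.2)
    have h4 := two_mul_triangular (x.1 - x.2)
    push_cast [natCast_natAbs_sq]; simp only [sq_abs]; nlinarith
  · refine hasSum_monomial_congr hm (fun x => ?_) fun _ => rfl
    have h1 := two_mul_triangular x.1
    have h3 := two_mul_triangular (x.1 + x.2)
    have h4 := two_mul_triangular (-1 - (x.1 - x.2))
    push_cast [natCast_natAbs_sq]; simp only [sq_abs]; nlinarith

end PowerSeries

/-! ### Product formulas for the theta series -/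

section FiniteGauss

variable {R : Type*} [CommRing R]

/-- The right side is an explicit antidifference in the summation index of the recurrence from n to
n + 1; the case m = n drives the induction for the finite Gauss identity. -/
theorem sum_gauss_telescope (q : R) (n m : ℕ) (hm : m ≤ n) :
    ∑ s ∈ Finset.range (m + 1), ((-1) ^ s * q ^ (s * (n + 2)) *
        (∏ k ∈ Finset.range s, (1 + q ^ k)) * (∏ k ∈ Finset.Ico s (n + 1), (1 - q ^ (k + 1))) -
      (1 + q ^ (n + 1)) * ((-1) ^ s * q ^ (s * (n + 1)) *
        (∏ k ∈ Finset.range s, (1 + q ^ k)) * (∏ k ∈ Finset.Ico s n, (1 - q ^ (k + 1))))) =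
    (-1) ^ (m + 1) * q ^ ((m + 1) * (n + 1)) * (∏ k ∈ Finset.range (m + 1), (1 + q ^ k)) *
      ∏ k ∈ Finset.Ico m n, (1 - q ^ (k + 1)) := by
  induction m with
  | zero =>
    rw [Finset.sum_range_one, Finset.prod_Ico_succ_top (Nat.zero_le n)]
    simp
    ring
  | succ m ih =>
    rw [Finset.sum_range_succ, ih (by omega), Finset.prod_eq_prod_Ico_succ_bot (show m < n by omega),
      Finset.prod_Ico_succ_top hm, Finset.prod_range_succ _ (m + 1)]
    ring

/-- A finite form of Gauss's identity `∑ (-1) ^ n q ^ (n ^ 2) = (q; q)_∞ / (-q; q)_∞`. -/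
theorem prod_one_add_mul_sum_neg_one_pow_sq (q : R) (n : ℕ) :
    (∏ k ∈ Finset.range n, (1 + q ^ (k + 1))) *
        (1 + 2 * ∑ k ∈ Finset.range n, (-1) ^ (k + 1) * q ^ ((k + 1) ^ 2)) =
      ∑ s ∈ Finset.range (n + 1), (-1) ^ s * q ^ (s * (n + 1)) *
        (∏ k ∈ Finset.range s, (1 + q ^ k)) * ∏ k ∈ Finset.Ico s n, (1 - q ^ (k + 1)) := by
  induction n with
  | zero => simp
  | succ n ih =>
    -- The boundary term and the leftover summand s = n + 1 combine to the factor 1 + q^(n+1), while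
    -- the factor 1 + q⁰ = 2 supplies the coefficient of the new square power.
    have h := sum_gauss_telescope q n n le_rfl
    rw [Finset.sum_sub_distrib, ← Finset.mul_sum, ← ih, sub_eq_iff_eq_add] at h
    rw [Finset.sum_range_succ _ (n + 1), h, Finset.prod_range_succ _ n, Finset.sum_range_succ _ n,
      Finset.prod_range_succ' _ n]
    simp
    ring

end FiniteGauss

namespace PowerSeries

open Filter Topology

theorem tendsto_of_eq_add_X_pow_mul {f g : ℕ → PowerSeries ℚ} {a : PowerSeries ℚ}
    (hf : Tendsto f atTop (𝓝 a)) (r : ℕ → PowerSeries ℚ)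
    (h : ∀ n, g n = f n + X ^ (n + 1) * r n) : Tendsto g atTop (𝓝 a) := by
  rw [WithPiTopology.tendsto_iff_coeff_tendsto] at hf ⊢
  intro d
  refine (hf d).congr' ?_
  filter_upwards [eventually_ge_atTop d] with n hn
  rw [h, map_add, coeff_X_pow_mul', if_neg (by omega), add_zero]

/-- The Euler product `∏ (1 - q ^ n)`. -/
noncomputable def euler : PowerSeries ℚ := qPochhammerInf X X

theorem hasProd_euler : HasProd (fun i : ℕ => (1 : PowerSeries ℚ) - X ^ (i + 1)) euler := by
  simp only [pow_succ']
  exact (multipliable_qPochhammerInf X X (by simp)).hasProd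

theorem hasProd_expand_euler (p : ℕ) (hp : p ≠ 0) :
    HasProd (fun i : ℕ => (1 : PowerSeries ℚ) - X ^ (p * (i + 1))) (expand p hp euler) := by
  have := hasProd_euler.map (expand p hp) (continuous_expand p hp)
  simpa [Function.comp_def, pow_mul] using this

theorem expand_two_euler : expand 2 two_ne_zero euler = qPochhammerInf (X ^ 2) (X ^ 2) := by
  refine (hasProd_expand_euler 2 two_ne_zero).unique ?_
  simp only [pow_mul, pow_succ' (X ^ 2)]
  exact (multipliable_qPochhammerInf (X ^ 2) (X ^ 2) (by simp)).hasProd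

theorem constantCoeff_euler : constantCoeff euler = 1 := by
  have h := hasProd_euler.map (constantCoeff (R := ℚ)) (WithPiTopology.continuous_constantCoeff ℚ)
  simp only [Function.comp_def, map_sub, map_one, map_pow, constantCoeff_X, 
    zero_pow (Nat.succ_ne_zero _), sub_zero] at h
  exact h.unique hasProd_one

theorem tendsto_partial_thetaPhiNeg :
    Tendsto (fun n : ℕ => (1 + 2 * ∑ k ∈ Finset.range n, (-1) ^ (k + 1) * X ^ ((k + 1) ^ 2) :
      PowerSeries ℚ)) atTop (𝓝 thetaPhiNeg) := by
  have h := hasSum_thetaPhiNeg.nat_add_neg.tendsto_sum_nat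
  -- Pairing n with -n counts the index 0 twice; the extra 1 is subtracted.
  have h' := ((tendsto_add_atTop_iff_nat 1).2 h).sub_const 1
  have e0 : monomial ((0 : ℤ).natAbs ^ 2) ((-1 : ℚ) ^ (0 : ℤ).natAbs) = 1 := by simp
  rw [e0, add_sub_cancel_right] at h'
  refine h'.congr fun n => ?_
  rw [Finset.sum_range_succ']
  have (k : ℕ) : (monomial (((k + 1 : ℕ) : ℤ).natAbs ^ 2)) ((-1 : ℚ) ^ ((k + 1 : ℕ) : ℤ).natAbs) +
      (monomial ((-((k + 1 : ℕ) : ℤ)).natAbs ^ 2)) ((-1 : ℚ) ^ (-((k + 1 : ℕ) : ℤ)).natAbs) =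
      2 * ((-1) ^ (k + 1) * X ^ ((k + 1) ^ 2)) := by
    rw [Int.natAbs_neg, Int.natAbs_natCast, monomial_eq_C_mul_X_pow]
    simp
    ring
  simp_rw [this, ← Finset.mul_sum]
  simp
  ring

/-- The product `(-q; q)_∞`. -/
noncomputable def eulerNeg : PowerSeries ℚ := ∏' i : ℕ, (1 + X ^ (i + 1))

theorem hasProd_eulerNeg : HasProd (fun i : ℕ => (1 : PowerSeries ℚ) + X ^ (i + 1)) eulerNeg := by
  have := multipliable_qPochhammerInf (-X) X (by simp)
  refine Multipliable.hasProd ?_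
  convert this using 2 with i
  ring

theorem euler_mul_eulerNeg : euler * eulerNeg = expand 2 two_ne_zero euler := by
  refine (hasProd_euler.mul hasProd_eulerNeg).unique ?_
  convert hasProd_expand_euler 2 two_ne_zero using 2 with i
  ring

/-- In the finite Gauss identity the summand s = 0 is the partial Euler product and every other
summand is divisible by X^(n+1), so only the former survives in the limit. -/
theorem eulerNeg_mul_thetaPhiNeg : eulerNeg * thetaPhiNeg = euler := by
  have h1 := hasProd_eulerNeg.tendsto_prod_nat.mul tendsto_partial_thetaPhiNeg
  refine tendsto_nhds_unique h1 (tendsto_of_eq_add_X_pow_mul hasProd_euler.tendsto_prod_nat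
    (fun n => ∑ s ∈ Finset.range n, (-1) ^ (s + 1) * X ^ (s * (n + 1)) *
        (∏ k ∈ Finset.range (s + 1), (1 + X ^ k)) * ∏ k ∈ Finset.Ico (s + 1) n, (1 - X ^ (k + 1)))
    fun n => ?_)
  rw [prod_one_add_mul_sum_neg_one_pow_sq, Finset.sum_range_succ', add_comm, Finset.mul_sum]
  congr 1
  · simp
  · refine Finset.sum_congr rfl fun s _ => ?_
    ring

/-- Gauss: `φ(-q) = (q; q)_∞² / (q²; q²)_∞`. -/
theorem thetaPhiNeg_mul_expand_euler : thetaPhiNeg * expand 2 two_ne_zero euler = euler ^ 2 := by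
  linear_combination euler * eulerNeg_mul_thetaPhiNeg - thetaPhiNeg * euler_mul_eulerNeg

theorem constantCoeff_thetaPsi : constantCoeff thetaPsi = 2 := by
  have h := hasSum_thetaPsi.map (constantCoeff (R := ℚ)) (WithPiTopology.continuous_constantCoeff ℚ)
  have h0 : triangular 0 = 0 := by decide
  have h1 : triangular (-1) = 0 := by decide
  have h' := hasSum_sum_of_ne_finset_zero (L := .unconditional ℤ) (s := {0, -1})
    (f := constantCoeff ∘ fun n : ℤ => monomial (triangular n) (1 : ℚ)) fun n hn => by
      have h2 := two_mul_triangular n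
      simp only [Finset.mem_insert, Finset.mem_singleton, not_or] at hn
      have h3 : n * (n + 1) ≠ 0 := mul_ne_zero hn.1 fun h => hn.2 (by omega)
      rw [Function.comp_apply, ← coeff_zero_eq_constantCoeff_apply, coeff_monomial, if_neg]
      omega
  rw [h.unique h', Finset.sum_pair (by norm_num)]
  simp [h0, h1]
  norm_num

/-- A power series with constant term `1` and `r(q)² = r(q²)` is `1`. -/
theorem eq_one_of_sq_eq_expand {r : PowerSeries ℚ} (h0 : constantCoeff r = 1)
    (h : r ^ 2 = expand 2 two_ne_zero r) : r = 1 := by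
  by_contra hne
  have hs : r - 1 ≠ 0 := sub_ne_zero.2 hne
  have h1 : (r - 1) * (r + 1) = expand 2 two_ne_zero (r - 1) := by
    rw [map_sub, map_one, ← h]; ring
  have h2 : (r + 1).order = 0 := by
    refine not_not.1 (order_ne_zero_iff_constCoeff_eq_zero.not.2 ?_)
    simp [h0]
  -- With m the order of r - 1, the left side has order m because r + 1 has constant term 2, while
  -- the right side has order 2m. Thus m = 0 or m = ∞, both excluded.
  have h3 := congrArg order h1
  rw [order_mul, h2, order_expand, add_zero] at h3
  have h4 : (r - 1).order ≠ ⊤ := order_eq_top.not.2 hs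
  have h5 : (r - 1).order ≠ 0 := by
    exact order_ne_zero_iff_constCoeff_eq_zero.2 (by simp [h0])
  lift (r - 1).order to ℕ using h4 with m hm
  rw [two_nsmul] at h3
  norm_cast at h3 h5
  omega

/-- Gauss: `ψ(q) = (q²; q²)_∞² / (q; q)_∞`. -/
theorem thetaPsi_mul_euler : thetaPsi * euler = 2 * expand 2 two_ne_zero euler ^ 2 := by
  obtain ⟨u, hu⟩ : ∃ u, expand 2 two_ne_zero euler * u = 1 :=
    ⟨_, PowerSeries.mul_inv_cancel _ (by simp [constantCoeff_euler])⟩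
  have hc : C (1 / 2 : ℚ) * 2 = 1 := by
    rw [← map_ofNat (C (R := ℚ)) 2, ← map_mul]
    norm_num
  have hv := congrArg (expand 2 two_ne_zero) hu
  have hf := thetaPhi_mul_thetaPhiNeg
  have hE := thetaPhiNeg_mul_expand_euler
  have hE2 := congrArg (expand 2 two_ne_zero) hE
  have ha := thetaPsi_sq
  rw [map_mul, map_one] at hv
  rw [map_mul, map_pow] at hE2
  -- This is r = ψ(q)(q;q)_∞/(q²;q²)_∞². The relations for Ψ(q)² and φ(q)φ(-q), with the product for
  -- φ(-q), give r(q)² = r(q²), which forces r = 1.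
  have key : C (1 / 2 : ℚ) * thetaPsi * euler * u ^ 2 = 1 := by
    apply eq_one_of_sq_eq_expand
    · have := congrArg constantCoeff hu
      simp only [map_mul, constantCoeff_expand, constantCoeff_euler, one_mul, map_one] at this
      simp [constantCoeff_euler, constantCoeff_thetaPsi, this]
    · simp only [map_mul, map_pow, expand_C]
      generalize expand 2 two_ne_zero u = v at *
      generalize expand 2 two_ne_zero (expand 2 two_ne_zero euler) = E4 at *
      generalize expand 2 two_ne_zero euler = E2 at *
      generalize expand 2 two_ne_zero thetaPhiNeg = f2 at *
      generalize expand 2 two_ne_zero thetaPsi = b at *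
      have h1 : f2 = E2 ^ 2 * v := by linear_combination v * hE2 - f2 * hv
      have h2 : thetaPhi * thetaPhiNeg = E2 ^ 4 * v ^ 2 := by rw [hf, h1]; ring
      have h3 : E2 ^ 4 * u ^ 4 = 1 := by rw [← mul_pow, hu, one_pow]
      calc _ = C (1 / 2 : ℚ) ^ 2 * thetaPsi ^ 2 * euler ^ 2 * u ^ 4 := by ring
        _ = (C (1 / 2 : ℚ) * 2) * C (1 / 2 : ℚ) * (thetaPhi * thetaPhiNeg) * b * E2 * u ^ 4 := by
          rw [ha, ← hE]; ring
        _ = C (1 / 2 : ℚ) * (E2 ^ 4 * u ^ 4) * v ^ 2 * b * E2 := by rw [hc, h2]; ring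
        _ = _ := by rw [h3]; ring
  generalize expand 2 two_ne_zero euler = E2 at *
  calc thetaPsi * euler = (C (1 / 2 : ℚ) * 2) * (E2 * u) ^ 2 * (thetaPsi * euler) := by
        rw [hc, hu]; ring
    _ = 2 * E2 ^ 2 * (C (1 / 2 : ℚ) * thetaPsi * euler * u ^ 2) := by ring
    _ = _ := by rw [key, mul_one]

end PowerSeries

/-! ### The generating function of 01-partitions -/

theorem is01Partition_nil : Is01Partition 0 [] where
  sum_eq := rfl
  last_pos := fun h => absurd rfl h
  step_one := fun i h => by simp at h
  step_two := fun i h => by simp at h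

theorem is01Partition_cons_iff {n a : ℕ} {l : List ℕ} :
    Is01Partition n (a :: l) ↔ a ≤ n ∧ Is01Partition (n - a) l ∧ (l = [] → 1 ≤ a) ∧
      (∀ h : 0 < l.length, l[0] ≤ a + 1) ∧ ∀ h : 1 < l.length, l[1] ≤ a := by
  constructor
  · intro h
    have hs := h.sum_eq
    rw [List.sum_cons] at hs
    refine ⟨by omega, ?_, ?_, fun hl => ?_, fun hl => ?_⟩
    · rw [← hs, Nat.add_sub_cancel_left]
      exact h.tail
    · rintro rfl
      exact h.last_pos (by simp)
    · exact h.step_one 0 (by rw [List.length_cons]; omega)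
    · exact h.step_two 0 (by rw [List.length_cons]; omega)
  · rintro ⟨ha, h, h0, h1, h2⟩
    refine ⟨?_, fun _ => ?_, fun i hi => ?_, fun i hi => ?_⟩
    · rw [List.sum_cons, h.sum_eq]
      omega
    · rcases eq_or_ne l [] with rfl | hl
      · simpa using h0 rfl
      · rw [List.getLast_cons hl]
        exact h.last_pos hl
    · rcases i with _ | i
      · exact h1 (by rw [List.length_cons] at hi; omega)
      · exact h.step_one i (by rw [List.length_cons] at hi; omega)
    · rcases i with _ | i
      · exact h2 (by rw [List.length_cons] at hi; omega)
      · exact h.step_two i (by rw [List.length_cons] at hi; omega)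

/-- The 01-partitions of `n` whose first entry is at most `a` and whose second entry is at
most `b`. -/
def bounded01Partitions (a b n : ℕ) : Set (List ℕ) :=
  {l | Is01Partition n l ∧ (∀ h : 0 < l.length, l[0] ≤ a) ∧ ∀ h : 1 < l.length, l[1] ≤ b}

theorem finite_bounded01Partitions (a b n : ℕ) : (bounded01Partitions a b n).Finite :=
  (finite_is01Partition n).subset fun _ h => h.1

/-- A second entry m + 1 forces the first to be m. Removing both leaves a list whose first two
entries are again bounded by m and m + 1, by the two-step condition. -/
theorem bounded01Partitions_diag_succ (m n : ℕ) : bounded01Partitions m (m + 1) n =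
    bounded01Partitions m m n ∪ (fun l => m :: (m + 1) :: l) ''
      {l | 2 * m + 1 ≤ n ∧ l ∈ bounded01Partitions m (m + 1) (n - (2 * m + 1))} := by
  ext l
  rcases l with _ | ⟨a, _ | ⟨b, l⟩⟩
  · simp [bounded01Partitions]
  · simp [bounded01Partitions]
  · simp only [bounded01Partitions, Set.mem_union, Set.mem_image, Set.mem_ofPred_eq,
      List.cons.injEq, is01Partition_cons_iff, Nat.sub_sub]
    constructor
    · rintro ⟨⟨h1, ⟨h2, h3, h4, h5, h6⟩, h7, h8, h9⟩, h10, h11⟩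
      simp at *
      by_cases hb : b ≤ m
      · exact Or.inl (by grind)
      · right
        obtain rfl : b = m + 1 := by omega
        obtain rfl : a = m := by omega
        simp
        grind
    · rintro (h | ⟨l', ⟨h1, h2, h3, h4⟩, rfl, rfl, rfl⟩)
      · simp at *
        grind
      · simp at *
        grind

/-- When a first entry m + 1 is removed, the old bound on the second entry bounds the new first one,
and the two-step condition bounds the new second one. -/
theorem bounded01Partitions_succ_diag (m n : ℕ) : bounded01Partitions (m + 1) (m + 1) n =
    bounded01Partitions m (m + 1) n ∪ (fun l => (m + 1) :: l) ''
      {l | m + 1 ≤ n ∧ l ∈ bounded01Partitions (m + 1) (m + 1) (n - (m + 1))} := by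
  ext l
  rcases l with _ | ⟨a, l⟩
  · simp [bounded01Partitions]
  · simp only [bounded01Partitions, Set.mem_union, Set.mem_image, Set.mem_ofPred_eq,
      List.cons.injEq, is01Partition_cons_iff]
    constructor
    · rintro ⟨⟨h1, h2, h3, h4, h5⟩, h6, h7⟩
      simp at *
      by_cases hb : a ≤ m
      · exact Or.inl (by grind)
      · right
        obtain rfl : a = m + 1 := by omega
        simp
        grind
    · rintro (h | ⟨l', ⟨h1, h2, h3, h4⟩, rfl, rfl⟩)
      · simp at *
        grind
      · simp at *
        grind

theorem ncard_union_image {n w : ℕ} {s t : Set (List ℕ)} {S : ℕ → Set (List ℕ)}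
    {g : List ℕ → List ℕ} (hg : g.Injective) (ht : t.Finite) (hS : ∀ n, (S n).Finite)
    (hd : ∀ l, g l ∉ t) (h : s = t ∪ g '' {l | w ≤ n ∧ l ∈ S (n - w)}) :
    s.ncard = t.ncard + if w ≤ n then (S (n - w)).ncard else 0 := by
  have hf : {l | w ≤ n ∧ l ∈ S (n - w)}.Finite := (hS (n - w)).subset fun l h => h.2
  rw [h, Set.ncard_union_eq _ ht (hf.image g), Set.ncard_image_of_injective _ hg]
  · split_ifs with hw <;> simp [hw]
  · rw [Set.disjoint_right]
    rintro _ ⟨l, -, rfl⟩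
    exact hd l

namespace PowerSeries

/-- The generating function of 01-partitions with bounded first two entries. -/
noncomputable def bounded01GenFun (a b : ℕ) : PowerSeries ℚ :=
  mk fun n => ((bounded01Partitions a b n).ncard : ℚ)

theorem bounded01GenFun_diag_succ (m : ℕ) : bounded01GenFun m (m + 1) =
    bounded01GenFun m m + X ^ (2 * m + 1) * bounded01GenFun m (m + 1) := by
  ext n
  have := ncard_union_image (fun _ _ h => by simpa using h) (finite_bounded01Partitions _ _ _)
    (finite_bounded01Partitions _ _) (fun l h => Nat.not_succ_le_self m (h.2.2 (by simp)))
    (bounded01Partitions_diag_succ m n)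
  rw [map_add, coeff_X_pow_mul', bounded01GenFun, bounded01GenFun, coeff_mk, coeff_mk, coeff_mk,
    this]
  push_cast
  rfl

theorem bounded01GenFun_succ_diag (m : ℕ) : bounded01GenFun (m + 1) (m + 1) =
    bounded01GenFun m (m + 1) + X ^ (m + 1) * bounded01GenFun (m + 1) (m + 1) := by
  ext n
  have := ncard_union_image (fun _ _ h => by simpa using h) (finite_bounded01Partitions _ _ _)
    (finite_bounded01Partitions _ _) (fun l h => Nat.not_succ_le_self m (h.2.1 (by simp)))
    (bounded01Partitions_succ_diag m n)
  rw [map_add, coeff_X_pow_mul', bounded01GenFun, bounded01GenFun, coeff_mk, coeff_mk, coeff_mk,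
    this]
  push_cast
  rfl

theorem bounded01Partitions_zero (n : ℕ) :
    bounded01Partitions 0 0 n = if n = 0 then {[]} else ∅ := by
  ext l
  constructor
  · rintro ⟨h, h0, h1⟩
    rcases l with _ | ⟨a, _ | ⟨b, l⟩⟩
    · have := h.sum_eq
      simp at this
      simp [← this]
    · have := h.last_pos (by simp)
      simp at *
      omega
    · have := h.one_le_add
      simp at *
      omega
  · split_ifs with hn
    · rintro rfl
      subst hn
      exact ⟨is01Partition_nil, by simp, by simp⟩
    · exact fun h => absurd h (Set.notMem_empty l)

theorem bounded01GenFun_zero : bounded01GenFun 0 0 = 1 := by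
  ext n
  rw [bounded01GenFun, coeff_mk, bounded01Partitions_zero, coeff_one]
  split_ifs <;> simp

/-- The bounds climb from (m, m) to (m, m+1) to (m+1, m+1). The first move allows repeated leading
pairs of weight 2m + 1, the second repeated leading entries m + 1, so each contributes a geometric
factor. -/
theorem bounded01GenFun_mul_prod (m : ℕ) : bounded01GenFun m m *
    ∏ i ∈ Finset.range m, ((1 - X ^ (i + 1)) * (1 - X ^ (2 * i + 1))) = 1 := by
  induction m with
  | zero => simp [bounded01GenFun_zero]
  | succ m ih =>
    rw [Finset.prod_range_succ]
    linear_combination ih + (∏ i ∈ Finset.range m, ((1 - X ^ (i + 1)) * (1 - X ^ (2 * i + 1)))) *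
      ((1 - X ^ (2 * m + 1)) * bounded01GenFun_succ_diag m + bounded01GenFun_diag_succ m)

theorem bounded01Partitions_of_le {m n : ℕ} (h : n ≤ m) :
    bounded01Partitions m m n = {l | Is01Partition n l} := by
  ext l
  refine ⟨fun hl => hl.1, fun hl => ⟨hl, fun h0 => ?_, fun h0 => ?_⟩⟩ <;>
  · refine (List.single_le_sum (fun _ _ => Nat.zero_le _) _ (List.getElem_mem h0)).trans ?_
    rwa [hl.sum_eq]

open Filter Topology

/-- The generating function of 01-partitions. -/
noncomputable def genFun01 : PowerSeries ℚ := mk fun n => (num01Partitions n : ℚ)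

theorem tendsto_bounded01GenFun :
    Tendsto (fun m => bounded01GenFun m m) atTop (𝓝 genFun01) := by
  rw [WithPiTopology.tendsto_iff_coeff_tendsto]
  intro d
  refine tendsto_atTop_of_eventually_const (i₀ := d) fun m hm => ?_
  rw [bounded01GenFun, genFun01, coeff_mk, coeff_mk, bounded01Partitions_of_le hm, num01Partitions]

/-- The product `(q; q²)_∞`. -/
noncomputable def eulerOdd : PowerSeries ℚ := ∏' i : ℕ, (1 - X ^ (2 * i + 1))

theorem hasProd_eulerOdd :
    HasProd (fun i : ℕ => (1 : PowerSeries ℚ) - X ^ (2 * i + 1)) eulerOdd := by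
  refine Multipliable.hasProd ?_
  convert multipliable_qPochhammerInf X (X ^ 2) (by simp) using 2 with i
  ring

theorem eulerOdd_mul_expand_euler : eulerOdd * expand 2 two_ne_zero euler = euler := by
  -- Factors are indexed from 0 with exponent i + 1, so even indices carry the odd exponents.
  refine HasProd.unique (HasProd.even_mul_odd ?_ ?_) hasProd_euler
  · exact hasProd_eulerOdd
  · exact hasProd_expand_euler 2 two_ne_zero

theorem genFun01_mul_euler_mul_eulerOdd : genFun01 * (euler * eulerOdd) = 1 := by
  have h := tendsto_bounded01GenFun.mul (hasProd_euler.mul hasProd_eulerOdd).tendsto_prod_nat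
  simp_rw [bounded01GenFun_mul_prod] at h
  exact tendsto_nhds_unique h tendsto_const_nhds

theorem expand_euler_ne_zero (p : ℕ) (hp : p ≠ 0) : expand p hp euler ≠ 0 := fun h => by
  simpa [constantCoeff_euler] using congrArg constantCoeff h

theorem genFun01_mul_thetaPhiNeg : genFun01 * thetaPhiNeg = 1 := by
  apply mul_right_cancel₀ (expand_euler_ne_zero 2 two_ne_zero)
  linear_combination genFun01 * thetaPhiNeg_mul_expand_euler -
    genFun01 * euler * eulerOdd_mul_expand_euler +
    expand 2 two_ne_zero euler * genFun01_mul_euler_mul_eulerOdd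

end PowerSeries

/-! ### Extracting an arithmetic progression of coefficients -/

namespace PowerSeries

/-- The series formed by the coefficients of `f` of index congruent to `r` modulo `p`. -/
noncomputable def sect (p r : ℕ) (f : PowerSeries ℚ) : PowerSeries ℚ :=
  mk fun n => coeff (p * n + r) f

theorem sect_add (p r : ℕ) (f g : PowerSeries ℚ) : sect p r (f + g) = sect p r f + sect p r g := by
  ext n
  simp [sect]

theorem sect_sum {ι : Type*} (p r : ℕ) (s : Finset ι) (f : ι → PowerSeries ℚ) :
    sect p r (∑ i ∈ s, f i) = ∑ i ∈ s, sect p r (f i) := by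
  ext n
  simp [sect]

theorem sect_X_pow_mul_expand_self (p r : ℕ) (hp : p ≠ 0) (g : PowerSeries ℚ) :
    sect p r (X ^ r * expand p hp g) = g := by
  ext n
  rw [sect, coeff_mk, coeff_X_pow_mul, coeff_expand_mul]

/-- Allowing a proper divisor d of p discards a series in q⁴ by its residue mod 4 without dissecting
it mod 8. -/
theorem sect_X_pow_mul_expand_of_ne {p r i d : ℕ} (hd : d ≠ 0) (hdp : d ∣ p)
    (hi : i % d ≠ r % d) (g : PowerSeries ℚ) : sect p r (X ^ i * expand d hd g) = 0 := by
  ext n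
  rw [sect, coeff_mk, coeff_X_pow_mul', map_zero]
  split_ifs with h
  · refine coeff_expand_of_not_dvd d hd g fun hdvd => hi ?_
    have h1 : i ≡ p * n + r [MOD d] := (Nat.modEq_iff_dvd' h).2 hdvd
    have h2 : p * n ≡ 0 [MOD d] := (Nat.modEq_zero_iff_dvd).2 (hdp.mul_right n)
    have h3 := h1.trans (h2.add_right r)
    rw [zero_add] at h3
    exact h3
  · rfl

theorem eq_sum_sect (p : ℕ) (hp : p ≠ 0) (f : PowerSeries ℚ) :
    f = ∑ r ∈ Finset.range p, X ^ r * expand p hp (sect p r f) := by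
  ext n
  rw [map_sum, Finset.sum_eq_single_of_mem (n % p)
    (Finset.mem_range.2 (Nat.mod_lt _ (Nat.pos_of_ne_zero hp)))]
  · conv_rhs => rw [← Nat.div_add_mod n p]
    rw [Nat.mul_add_mod_self_left, Nat.mod_mod, coeff_X_pow_mul, coeff_expand_mul, sect,
      coeff_mk, Nat.div_add_mod]
  · intro r hr hne
    rw [coeff_X_pow_mul']
    split_ifs with h
    · refine coeff_expand_of_not_dvd p hp _ fun hdvd => hne ?_
      have h1 : r ≡ n [MOD p] := (Nat.modEq_iff_dvd' h).2 hdvd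
      rw [← h1, Nat.mod_eq_of_lt (Finset.mem_range.1 hr)]
    · rfl

/-- Multiplying by a series in q^p does not mix residue classes mod p. -/
theorem sect_mul_expand {p r : ℕ} (hp : p ≠ 0) (hr : r < p) (f g : PowerSeries ℚ) :
    sect p r (f * expand p hp g) = sect p r f * g := by
  conv_lhs => rw [eq_sum_sect p hp f, Finset.sum_mul, sect_sum]
  simp_rw [mul_assoc, ← map_mul]
  rw [Finset.sum_eq_single_of_mem r (Finset.mem_range.2 hr), sect_X_pow_mul_expand_self]
  intro i hi hne
  apply sect_X_pow_mul_expand_of_ne hp dvd_rfl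
  rwa [Nat.mod_eq_of_lt (Finset.mem_range.1 hi), Nat.mod_eq_of_lt hr]

/-! ### The residue class 7 mod 8 of 1/φ(-q) -/

theorem genFun01_mul_expand_thetaPhiNeg :
    genFun01 * expand 8 (by norm_num) (thetaPhiNeg ^ 8) = thetaPhi *
      expand 2 two_ne_zero thetaPhi ^ 2 * expand 4 four_ne_zero thetaPhi ^ 4 := by
  have h1 := thetaPhi_mul_thetaPhiNeg
  have h2 := congrArg (expand 2 two_ne_zero) h1
  have h4 := congrArg (expand 4 four_ne_zero) h1
  simp only [map_mul, map_pow, ← expand_mul] at h2 h4 ⊢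
  norm_num at h2 h4
  rw [show expand 8 (by norm_num) thetaPhiNeg ^ 8 =
    (expand 8 (by norm_num) thetaPhiNeg ^ 2) ^ 4 by ring, ← h4, mul_pow,
    show expand 4 (by norm_num) thetaPhiNeg ^ 4 =
    (expand 4 (by norm_num) thetaPhiNeg ^ 2) ^ 2 by ring, ← h2, mul_pow, ← h1]
  linear_combination thetaPhi *
      expand 2 two_ne_zero thetaPhi ^ 2 * expand 4 four_ne_zero thetaPhi ^ 4 *
      genFun01_mul_thetaPhiNeg

theorem sect_genFun01_mul : 2 * (sect 8 7 genFun01 * thetaPhiNeg ^ 8) = thetaPsi ^ 7 := by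
  have h8 : (8 : ℕ) ≠ 0 := by norm_num
  have h1 := thetaPhi_eq_expand_add
  have h2 := congrArg (expand 2 two_ne_zero) thetaPhi_sq
  have h4 := congrArg (expand 4 four_ne_zero) thetaPhi_sq
  simp only [map_mul, map_pow, map_add, expand_X, ← expand_mul] at h2 h4
  norm_num at h2 h4
  -- With u = φ(q⁴) and c = Ψ(q⁸), the product is (u + qc)(u² + q²c²)u⁴. Only q³c³u⁴ can meet 7 mod
  -- 8, so only there is u² = φ(q⁸)² + q⁴Ψ(q¹⁶)² substituted; its cross term gives the q⁷ part.
  have key : thetaPhi *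
      expand 2 two_ne_zero thetaPhi ^ 2 * expand 4 four_ne_zero thetaPhi ^ 4 =
      X ^ 0 * expand 4 four_ne_zero (thetaPhi ^ 7) +
      X ^ 1 * expand 4 four_ne_zero (expand 2 two_ne_zero thetaPsi * thetaPhi ^ 6) +
      X ^ 2 * expand 4 four_ne_zero (expand 2 two_ne_zero thetaPsi ^ 2 * thetaPhi ^ 5) +
      X ^ 3 * expand 8 h8 (thetaPsi ^ 3 * (thetaPhi ^ 4 +
        X * expand 2 two_ne_zero thetaPsi ^ 4)) +
      X ^ 7 * expand 8 h8 (2 * (thetaPsi ^ 3 * thetaPhi ^ 2 *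
        expand 2 two_ne_zero thetaPsi ^ 2)) := by
    simp only [map_mul, map_pow, map_add, map_ofNat, expand_X, ← expand_mul]
    norm_num
    generalize expand 4 four_ne_zero thetaPhi = u at *
    generalize expand 8 h8 thetaPsi = c at *
    generalize expand 8 h8 thetaPhi = v at *
    rw [h2, h1]
    linear_combination X ^ 3 * c ^ 3 * (u ^ 2 + v ^ 2 +
      X ^ 4 * expand 16 (by norm_num) thetaPsi ^ 2) * h4
  rw [← sect_mul_expand h8 (by norm_num), genFun01_mul_expand_thetaPhiNeg, key]
  simp only [sect_add]
  rw [sect_X_pow_mul_expand_of_ne _ (by norm_num) (by norm_num),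
    sect_X_pow_mul_expand_of_ne _ (by norm_num) (by norm_num),
    sect_X_pow_mul_expand_of_ne _ (by norm_num) (by norm_num),
    sect_X_pow_mul_expand_of_ne _ (by norm_num) (by norm_num), sect_X_pow_mul_expand_self]
  -- What remains is Ψ³(2φ(q)Ψ(q²))² = Ψ³(Ψ²)².
  have := thetaPsi_sq
  linear_combination (-thetaPsi ^ 3) *
    (thetaPsi ^ 2 + 2 * thetaPhi * expand 2 two_ne_zero thetaPsi) * this

theorem sect_genFun01_mul_euler_pow :
    sect 8 7 genFun01 * euler ^ 23 = 64 * expand 2 two_ne_zero euler ^ 22 := by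
  have h := sect_genFun01_mul
  have hf := thetaPhiNeg_mul_expand_euler
  have hp := thetaPsi_mul_euler
  have h2 : (2 : PowerSeries ℚ) ≠ 0 := fun h => by
    have := congrArg (constantCoeff (R := ℚ)) h
    rw [map_ofNat, map_zero] at this
    norm_num at this
  apply mul_left_cancel₀ h2
  calc _ = 2 * (sect 8 7 genFun01 * (euler ^ 2) ^ 8) * euler ^ 7 := by ring
    _ = 2 * (sect 8 7 genFun01 * thetaPhiNeg ^ 8) * euler ^ 7 *
        expand 2 two_ne_zero euler ^ 8 := by rw [← hf]; ring
    _ = (thetaPsi * euler) ^ 7 * expand 2 two_ne_zero euler ^ 8 := by rw [h]; ring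
    _ = _ := by rw [hp]; ring

end PowerSeries

theorem proposition12 :
    (PowerSeries.mk fun n : ℕ => (num01Partitions (8 * n + 7) : ℚ)) =
      64 * (qPochhammerInf (PowerSeries.X ^ 2) (PowerSeries.X ^ 2) ^ 22 *
        (qPochhammerInf PowerSeries.X PowerSeries.X ^ 23)⁻¹) := by
  have h := PowerSeries.sect_genFun01_mul_euler_pow
  have hc : PowerSeries.constantCoeff (PowerSeries.euler ^ 23) ≠ 0 := by
    simp [PowerSeries.constantCoeff_euler]
  rw [PowerSeries.expand_two_euler] at h
  change _ = 64 * (_ * (PowerSeries.euler ^ 23)⁻¹)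
  rw [← mul_assoc, PowerSeries.eq_mul_inv_iff_mul_eq hc]
  simpa [PowerSeries.sect, PowerSeries.genFun01] using h
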